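/- **Theorem 1.3.** Let $(M,g)$ be a smooth Lorentzian manifold of dimension $m\ge 3$, i.e. $g$ is a smooth field of symmetric inner products of signature $(1,m-1)$ (one minus sign) on the tangent spaces of $M$. Let $R(x,y)z=\nabla_x\nabla_yz-\nabla_y\nabla_xz-\nabla_{[x,y]}z$ be the curvature of the Levi-Civita connection, put $R(x,y,z,w)=g(R(x,y)z,w)$, and define the Jacobi operator $\mathcal J_R(x)$ on $T_pM$ for $x\in T_pM$ by $g(\mathcal J_R(x)y,w)=R(y,x,x,w)$. For a $k$-dimensional subspace $\sigma\subset T_pM$ on which $g$ is non-degenerate, with a basis $e_1,\dots,e_k$ satisfying $g(e_i,e_j)=0$ for $i\ne j$ and $g(e_i,e_i)=\pm1$, let $$\mathcal J_R(\sigma)=\sum_{i=1}^k g(e_i,e_i)\,\mathcal J_R(e_i)$$ (this operator does not depend on the choice of the basis). Let $1\le k\le m-1$ and suppose that $(M,g)$ is $k$ Osserman: the complex eigenvalues of $\mathcal J_R(\sigma)$, counted with algebraic multiplicity, are the same for all points $p\in M$ and all non-degenerate $k$-dimensional subspaces $\sigma\subset T_pM$. Then $(M,g)$ has constant sectional curvature: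 there is a real number $c$ such that for every $p\in M$ and all $x,y\in T_pM$ with $g(x,x)g(y,y)-g(x,y)^2\neq0$, $$\frac{R(x,y,y,x)}{g(x,x)g(y,y)-g(x,y)^2}=c .$$ -/

import Mathlib

set_option maxSynthPendingDepth 3

open scoped Manifold ContDiff

noncomputable section

namespace Osserman

/-! ### The Levi-Civita connection and its curvature in a coordinate domain

`G : E → E →L[ℝ] E →L[ℝ] ℝ` is a (pseudo-Riemannian) metric on an open subset of the
finite-dimensional vector space `E`. -/

section Coordinates

variable {E : Type*} [NormedAddCommGroup E] [NormedSpace ℝ E]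

/-- Christoffel symbols of the first kind, as a trilinear form in `u v w`
(see `christoffelFirst_apply` for the formula). -/
def christoffelFirst (G : E → E →L[ℝ] E →L[ℝ] ℝ) (y : E) : E →L[ℝ] E →L[ℝ] E →L[ℝ] ℝ :=
  let D : E →L[ℝ] E →L[ℝ] E →L[ℝ] ℝ := fderiv ℝ G y
  let swap : (E →L[ℝ] E →L[ℝ] ℝ) →L[ℝ] (E →L[ℝ] E →L[ℝ] ℝ) :=
    ContinuousLinearEquiv.toContinuousLinearMap
      (LinearIsometryEquiv.toContinuousLinearEquiv (ContinuousLinearMap.flipₗᵢ ℝ E E ℝ))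
  (1 / 2 : ℝ) • (D + D.flip - swap.comp D.flip)

/-- `Γ(u, v; w) = ½ (∂_u G(v, w) + ∂_v G(u, w) - ∂_w G(u, v))`. -/
theorem christoffelFirst_apply (G : E → E →L[ℝ] E →L[ℝ] ℝ) (y u v w : E) :
    christoffelFirst G y u v w =
      (1 / 2) * (fderiv ℝ G y u v w + fderiv ℝ G y v u w - fderiv ℝ G y w u v) := rfl

/-- Christoffel symbols of the second kind: `Γ(u, v)` is the vector `∇_u v` (for constant fields
`u`, `v`) determined by `G(Γ(u, v), w) = Γ(u, v; w)`. The inverse is that of the musical map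
`v ↦ G(v, ·)`, which is invertible wherever `G` is non-degenerate. -/
def christoffel (G : E → E →L[ℝ] E →L[ℝ] ℝ) (y : E) : E →L[ℝ] E →L[ℝ] E :=
  (ContinuousLinearMap.compL ℝ E (E →L[ℝ] ℝ) E (G y).inverse).comp (christoffelFirst G y)

/-- The curvature operator `R(u, v) w = ∇_u ∇_v w - ∇_v ∇_u w` (for constant fields `u`, `v`, `w`)
of the Levi-Civita connection `∇ = ∂ + Γ` of `G`, at the point `y`. -/
def coordCurvature (G : E → E →L[ℝ] E →L[ℝ] ℝ) (y u v w : E) : E :=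
  fderiv ℝ (christoffel G) y u v w - fderiv ℝ (christoffel G) y v u w
    + christoffel G y u (christoffel G y v w) - christoffel G y v (christoffel G y u w)

theorem coordCurvature_add (G : E → E →L[ℝ] E →L[ℝ] ℝ) (y u u₂ v w : E) :
    coordCurvature G y (u + u₂) v w = coordCurvature G y u v w + coordCurvature G y u₂ v w := by
  simp only [coordCurvature, map_add, add_apply]
  abel

theorem coordCurvature_smul (G : E → E →L[ℝ] E →L[ℝ] ℝ) (y : E) (c : ℝ) (u v w : E) :
    coordCurvature G y (c • u) v w = c • coordCurvature G y u v w := by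
  simp only [coordCurvature, map_smul, smul_apply, smul_add, smul_sub]

end Coordinates

/-! ### Lorentzian manifolds -/

variable (E : Type*) [NormedAddCommGroup E] [NormedSpace ℝ E]
variable (M : Type*) [TopologicalSpace M] [ChartedSpace E M] [IsManifold 𝓘(ℝ, E) ∞ M]

/-- A smooth Lorentzian metric on `M`: a smooth field of symmetric bilinear forms on the tangent
spaces, each of signature `(1, q)` (one minus sign, `q` plus signs). -/
structure LorentzianMetric where
  /-- the inner product on the tangent space at `p` -/
  inner (p : M) : TangentSpace 𝓘(ℝ, E) p →L[ℝ] TangentSpace 𝓘(ℝ, E) p →L[ℝ] ℝ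
  symm (p : M) (x y : TangentSpace 𝓘(ℝ, E) p) : inner p x y = inner p y x
  signature (p : M) : ∃ (q : ℕ) (b : Module.Basis (Fin (q + 1)) ℝ (TangentSpace 𝓘(ℝ, E) p)),
    ∀ i j, inner p (b i) (b j) = if i = j then (if i = 0 then -1 else 1) else 0
  contMDiff : ContMDiff 𝓘(ℝ, E) (𝓘(ℝ, E).prod 𝓘(ℝ, E →L[ℝ] E →L[ℝ] ℝ)) ∞
    (fun p ↦ Bundle.TotalSpace.mk' (E →L[ℝ] E →L[ℝ] ℝ)
      (E := fun p : M ↦ TangentSpace 𝓘(ℝ, E) p →L[ℝ] TangentSpace 𝓘(ℝ, E) p →L[ℝ] ℝ)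
      p (inner p))

namespace LorentzianMetric

variable {E M}
variable (g : LorentzianMetric E M)

/-- The metric in the preferred chart `φ` at `p`, that is, the pullback of `g` by `φ⁻¹`. -/
def chartMetric (p : M) (y : E) : E →L[ℝ] E →L[ℝ] ℝ :=
  let ψ := (extChartAt 𝓘(ℝ, E) p).symm
  let B : E →L[ℝ] E →L[ℝ] ℝ := g.inner (ψ y)
  let dψ : E →L[ℝ] E := mfderiv 𝓘(ℝ, E) 𝓘(ℝ, E) ψ y
  B.bilinearComp dψ dψ

/-- The differential at `p` of the preferred chart `φ` at `p`. -/
def dchart (p : M) : TangentSpace 𝓘(ℝ, E) p →L[ℝ] E :=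
  mfderiv 𝓘(ℝ, E) 𝓘(ℝ, E) (extChartAt 𝓘(ℝ, E) p) p

/-- The differential at `φ p` of `φ⁻¹`, where `φ` is the preferred chart at `p`. -/
def dchartSymm (p : M) : E →L[ℝ] TangentSpace 𝓘(ℝ, E) p :=
  mfderiv 𝓘(ℝ, E) 𝓘(ℝ, E) (extChartAt 𝓘(ℝ, E) p).symm (extChartAt 𝓘(ℝ, E) p p)

/-- The curvature operator `R(x, y) z` of the Levi-Civita connection of `g` at `p`, computed in the
preferred chart `φ` at `p`: tangent vectors are carried to `E` by `dφ` and the result is carried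
back by `d(φ⁻¹)`. -/
def curvature (p : M) (x y z : TangentSpace 𝓘(ℝ, E) p) : TangentSpace 𝓘(ℝ, E) p :=
  dchartSymm p (coordCurvature (g.chartMetric p) (extChartAt 𝓘(ℝ, E) p p)
    (dchart p x) (dchart p y) (dchart p z))

/-- The curvature tensor `R(x, y, z, w) = g(R(x, y) z, w)`. -/
def curvatureTensor (p : M) (x y z w : TangentSpace 𝓘(ℝ, E) p) : ℝ :=
  g.inner p (g.curvature p x y z) w

/-- The Jacobi operator `J(x) : y ↦ R(y, x) x`, so that `g(J(x) y, w) = R(y, x, x, w)`. -/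
def jacobi (p : M) (x : TangentSpace 𝓘(ℝ, E) p) :
    TangentSpace 𝓘(ℝ, E) p →ₗ[ℝ] TangentSpace 𝓘(ℝ, E) p where
  toFun y := g.curvature p y x x
  map_add' y z := by
    simp only [curvature, map_add, coordCurvature_add]
  map_smul' c y := by
    simp only [curvature, map_smul, coordCurvature_smul, RingHom.id_apply]

theorem inner_jacobi (p : M) (x y w : TangentSpace 𝓘(ℝ, E) p) :
    g.inner p (g.jacobi p x y) w = g.curvatureTensor p y x x w := rfl

/-- The subspace `σ` of the tangent space at `p` is non-degenerate: `g` restricted to it is. -/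
def IsNondegenerate (p : M) (σ : Submodule ℝ (TangentSpace 𝓘(ℝ, E) p)) : Prop :=
  ∀ x ∈ σ, (∀ y ∈ σ, g.inner p x y = 0) → x = 0

/-- `e` is an orthonormal basis of the subspace `σ`: it spans `σ`, and its members are mutually
orthogonal with `g(e i, e i) = ±1` (which makes them linearly independent). -/
def IsOrthonormalBasis (p : M) (σ : Submodule ℝ (TangentSpace 𝓘(ℝ, E) p)) {k : ℕ}
    (e : Fin k → TangentSpace 𝓘(ℝ, E) p) : Prop :=
  Submodule.span ℝ (Set.range e) = σ ∧
  (∀ i j, i ≠ j → g.inner p (e i) (e j) = 0) ∧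
  ∀ i, g.inner p (e i) (e i) = 1 ∨ g.inner p (e i) (e i) = -1

/-- The higher order Jacobi operator `J(σ) = ∑ i, g(e i, e i) J(e i)`, written in terms of an
orthonormal basis `e` of `σ`. -/
def higherJacobi (p : M) {k : ℕ} (e : Fin k → TangentSpace 𝓘(ℝ, E) p) :
    TangentSpace 𝓘(ℝ, E) p →ₗ[ℝ] TangentSpace 𝓘(ℝ, E) p :=
  ∑ i, g.inner p (e i) (e i) • g.jacobi p (e i)

/-- The complex eigenvalues, with algebraic multiplicity, of a linear endomorphism of a
finite-dimensional real vector space. -/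
def eigenvalues {V : Type*} [AddCommGroup V] [Module ℝ V] [FiniteDimensional ℝ V]
    (A : V →ₗ[ℝ] V) : Multiset ℂ :=
  A.charpoly.aroots ℂ

instance (p : M) [FiniteDimensional ℝ E] : FiniteDimensional ℝ (TangentSpace 𝓘(ℝ, E) p) :=
  inferInstanceAs (FiniteDimensional ℝ E)

/-- `(M, g)` is `k` Osserman: the eigenvalues of `J(σ)` are constant on the Grassmannian of all
non-degenerate `k`-planes `σ` in the tangent bundle of `M`. -/
def IsOsserman [FiniteDimensional ℝ E] (k : ℕ) : Prop :=
  ∃ Λ : Multiset ℂ, ∀ (p : M) (σ : Submodule ℝ (TangentSpace 𝓘(ℝ, E) p)),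
    Module.finrank ℝ σ = k → g.IsNondegenerate p σ →
    ∀ e : Fin k → TangentSpace 𝓘(ℝ, E) p, g.IsOrthonormalBasis p σ e →
      eigenvalues (g.higherJacobi p e) = Λ

/-- The squared area `g(x, x) g(y, y) - g(x, y)²`. It is non-zero exactly when `x`, `y` are a basis
of a non-degenerate plane. -/
def areaSq (p : M) (x y : TangentSpace 𝓘(ℝ, E) p) : ℝ :=
  g.inner p x x * g.inner p y y - g.inner p x y ^ 2

/-- `(M, g)` has constant sectional curvature: for some real `c`, every non-degenerate tangent
plane, at every point, has sectional curvature `c`. -/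
def HasConstantSectionalCurvature : Prop :=
  ∃ c : ℝ, ∀ (p : M) (x y : TangentSpace 𝓘(ℝ, E) p),
    g.areaSq p x y ≠ 0 → g.curvatureTensor p x y y x / g.areaSq p x y = c

end LorentzianMetric

end Osserman

end

/-! Only spacelike frames are needed. Let `e` be a unit timelike vector, `a` a unit spacelike vector
orthogonal to it, and `n = e + a`. Boosting in the plane of `e` and `a` gives unit spacelike vectors
that blow up in the direction of `n`. The spectrum of the higher Jacobi operator stays fixed along
the boost, so after rescaling the limit `J(n)` has only the eigenvalue zero, hence is nilpotent
(`jacobiOp_null_pow_eq_zero`).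

The metric is positive semi-definite on the orthogonal complement of `n`, and the self-adjoint
operator `J(n)` takes values there. Nilpotency therefore forces its quadratic form to vanish on that
complement (`apply_self_eq_zero_of_pow_eq_zero`), so curvature vanishes on degenerate planes.
Varying `a` makes the form `R(·, e, e, ·)` proportional to the metric on the complement of `e`,
which yields constant curvature at each point (`exists_forall_curvature_eq`).

The trace of the higher Jacobi operator is a fixed positive multiple of the curvature constant
(`trace_frameJacobi`). As it is read off from the spectrum, the constant is the same at all points;
no Schur lemma is required. The geometric input is that the coordinate curvature has the algebraic
symmetries of a curvature tensor (`isCurvatureOperator_coordCurvature`). -/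

namespace Osserman

/-! ### Lorentzian inner product spaces -/

section Algebra

variable {V : Type*} [AddCommGroup V] [Module ℝ V]

/-- `b` is a pseudo-orthonormal basis of signature `(1, q)` for the bilinear form `B`, with
timelike vector `b 0`. -/
def IsLorentzBasis (B : V →ₗ[ℝ] V →ₗ[ℝ] ℝ) {q : ℕ} (b : Module.Basis (Fin (q + 1)) ℝ V) : Prop :=
  ∀ i j, B (b i) (b j) = if i = j then (if i = 0 then -1 else 1) else 0

/-- The family `f` is orthonormal and spacelike for the bilinear form `B`. -/
def IsSpacelikeFrame (B : V →ₗ[ℝ] V →ₗ[ℝ] ℝ) {k : ℕ} (f : Fin k → V) : Prop :=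
  ∀ i j, B (f i) (f j) = if i = j then 1 else 0

/-- `R` is an algebraic curvature operator for the bilinear form `B` (only the symmetries that are
used below are recorded). -/
structure IsCurvatureOperator (B : V →ₗ[ℝ] V →ₗ[ℝ] ℝ) (R : V →ₗ[ℝ] V →ₗ[ℝ] V →ₗ[ℝ] V) :
    Prop where
  antisymm (x y z : V) : R x y z = -R y x z
  skew (x y z w : V) : B (R x y z) w = -B (R x y w) z
  pair_symm (x y z w : V) : B (R x y z) w = B (R z w x) y

/-- The Jacobi operator `y ↦ R(y, x) x`. -/
def jacobiOp (R : V →ₗ[ℝ] V →ₗ[ℝ] V →ₗ[ℝ] V) (x : V) : V →ₗ[ℝ] V where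
  toFun y := R y x x
  map_add' y z := by simp
  map_smul' c y := by simp

theorem jacobiOp_apply (R : V →ₗ[ℝ] V →ₗ[ℝ] V →ₗ[ℝ] V) (x y : V) : jacobiOp R x y = R y x x := rfl

/-- The sum of the Jacobi operators of the members of a spacelike frame. -/
def frameJacobi (R : V →ₗ[ℝ] V →ₗ[ℝ] V →ₗ[ℝ] V) {k : ℕ} (f : Fin k → V) : V →ₗ[ℝ] V :=
  ∑ i, jacobiOp R (f i)

variable {B : V →ₗ[ℝ] V →ₗ[ℝ] ℝ} {R : V →ₗ[ℝ] V →ₗ[ℝ] V →ₗ[ℝ] V}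

namespace IsLorentzBasis

variable {q : ℕ} {b : Module.Basis (Fin (q + 1)) ℝ V}

theorem timelike (hb : IsLorentzBasis B b) : B (b 0) (b 0) = -1 := by simp [hb 0 0]

theorem isSymm (hb : IsLorentzBasis B b) (x y : V) : B x y = B y x := by
  have : B = B.flip := by
    refine b.ext fun i ↦ b.ext fun j ↦ ?_
    rw [LinearMap.flip_apply, hb, hb]
    rcases eq_or_ne i j with rfl | h
    · rfl
    · simp [h, h.symm]
  exact congrArg (fun C ↦ C x y) this

theorem eq_zero_of_forall (hb : IsLorentzBasis B b) {x : V} (hx : ∀ y, B x y = 0) : x = 0 := by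
  refine b.ext_elem fun i ↦ ?_
  have h := hx (b i)
  rw [← b.sum_repr x] at h
  simp only [map_sum, LinearMap.sum_apply, map_smul, LinearMap.smul_apply, hb _ i,
    smul_eq_mul, mul_ite, mul_zero, Finset.sum_ite_eq', Finset.mem_univ, if_true] at h
  split_ifs at h <;> simpa using h

theorem isSpacelikeFrame_succ (hb : IsLorentzBasis B b) :
    IsSpacelikeFrame B (fun i : Fin q ↦ b i.succ) := fun i j ↦ by
  rw [hb]
  simp

theorem timelike_succ (hb : IsLorentzBasis B b) (i : Fin q) : B (b 0) (b i.succ) = 0 := by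
  rw [hb]
  simp [(Fin.succ_ne_zero i).symm]

/-- Vectors orthogonal to the timelike basis vector are combinations of the other ones. -/
theorem exists_eq_sum (hb : IsLorentzBasis B b) {y : V} (hy : B (b 0) y = 0) :
    ∃ v : EuclideanSpace ℝ (Fin q), y = ∑ i, v i • b i.succ := by
  refine ⟨WithLp.toLp 2 fun i ↦ b.repr y i.succ, ?_⟩
  have h0 : b.repr y 0 = 0 := by
    rw [← b.sum_repr y, Fin.sum_univ_succ] at hy
    simpa [hb.timelike, hb.timelike_succ] using hy
  conv_lhs => rw [← b.sum_repr y, Fin.sum_univ_succ, h0]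
  simp

/-- Makes the complement of the timelike vector isometric to Euclidean space, so that positivity and
orthonormal extension can be imported from there. -/
theorem apply_sum_sum (hb : IsLorentzBasis B b) (v w : EuclideanSpace ℝ (Fin q)) :
    B (∑ i, v i • b i.succ) (∑ i, w i • b i.succ) = inner ℝ v w := by
  simp only [map_sum, LinearMap.sum_apply, map_smul, LinearMap.smul_apply,
    hb.isSpacelikeFrame_succ _ _, smul_eq_mul, mul_ite, mul_one, mul_zero,
    PiLp.inner_apply, RCLike.inner_apply, conj_trivial]
  simp

theorem pos_of_orthogonal (hb : IsLorentzBasis B b) {y : V} (hy : B (b 0) y = 0) (h0 : y ≠ 0) :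
    0 < B y y := by
  obtain ⟨v, rfl⟩ := hb.exists_eq_sum hy
  rw [hb.apply_sum_sum]
  refine real_inner_self_pos.2 ?_
  rintro rfl
  simp at h0

theorem nonneg_of_orthogonal (hb : IsLorentzBasis B b) {y : V} (hy : B (b 0) y = 0) :
    0 ≤ B y y := by
  rcases eq_or_ne y 0 with rfl | h
  · simp
  · exact (hb.pos_of_orthogonal hy h).le

end IsLorentzBasis

/-- A spacelike unit vector orthogonal to the timelike basis vector extends to an orthonormal
basis of the orthogonal complement of the latter. -/
theorem IsLorentzBasis.exists_frame {q : ℕ} {b : Module.Basis (Fin (q + 1 + 1)) ℝ V}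
    (hb : IsLorentzBasis B b) {a : V} (hea : B (b 0) a = 0) (ha : B a a = 1) :
    ∃ f : Fin q → V, IsSpacelikeFrame B f ∧ ∀ i, B (b 0) (f i) = 0 ∧ B a (f i) = 0 := by
  obtain ⟨v, rfl⟩ := hb.exists_eq_sum hea
  rw [hb.apply_sum_sum] at ha
  -- The one-member family at index `0` extends to a Euclidean orthonormal basis; its members at
  -- successor indices give the frame.
  have hv : Orthonormal ℝ (Set.domRestrict ({0} : Set (Fin (q + 1))) (fun _ ↦ v)) := by
    refine ⟨fun i ↦ ?_, fun i j hij ↦ (hij (Subsingleton.elim _ _)).elim⟩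
    have : ‖v‖ ^ 2 = 1 := by rw [← real_inner_self_eq_norm_sq, ha]
    simpa [Set.domRestrict] using (pow_eq_one_iff_of_nonneg (norm_nonneg v) two_ne_zero).1 this
  obtain ⟨c, hc⟩ := hv.exists_orthonormalBasis_extension_of_card_eq (by simp)
  have hc0 : c 0 = v := hc 0 rfl
  refine ⟨fun i ↦ ∑ j, c i.succ j • b j.succ, fun i j ↦ ?_, fun i ↦ ⟨?_, ?_⟩⟩
  · rw [hb.apply_sum_sum, orthonormal_iff_ite.1 c.orthonormal]
    simp
  · simp [hb.timelike_succ]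
  · rw [hb.apply_sum_sum, ← hc0, orthonormal_iff_ite.1 c.orthonormal]
    simp [(Fin.succ_ne_zero i).symm]

theorem IsSpacelikeFrame.apply_sum {k : ℕ} {f : Fin k → V} (hf : IsSpacelikeFrame B f)
    (c : Fin k → ℝ) (j : Fin k) : B (∑ i, c i • f i) (f j) = c j := by
  simp [hf _ j]

theorem IsSpacelikeFrame.linearIndependent {k : ℕ} {f : Fin k → V}
    (hf : IsSpacelikeFrame B f) : LinearIndependent ℝ f := by
  refine Fintype.linearIndependent_iff.2 fun c hc j ↦ ?_
  rw [← hf.apply_sum c j, hc]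
  simp

theorem IsSpacelikeFrame.eq_zero_of_mem_span {k : ℕ} {f : Fin k → V}
    (hf : IsSpacelikeFrame B f) {x : V} (hx : x ∈ Submodule.span ℝ (Set.range f))
    (h : ∀ j, B x (f j) = 0) : x = 0 := by
  obtain ⟨c, rfl⟩ := (Submodule.mem_span_range_iff_exists_fun ℝ).1 hx
  exact Finset.sum_eq_zero fun j _ ↦ by rw [← hf.apply_sum c j, h j, zero_smul]

/-! ### Nilpotency of Jacobi operators of null vectors -/

/-- If `δ⁻¹ • A(δ)` has the same characteristic polynomial for all `δ > 0`, where
`A(δ) = A₀ + δ A₁ + δ² A₂`, then `A₀` is nilpotent. -/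
theorem pow_finrank_eq_zero_of_charpoly_eq [FiniteDimensional ℝ V] (A₀ A₁ A₂ : V →ₗ[ℝ] V)
    (P : Polynomial ℝ)
    (h : ∀ δ : ℝ, 0 < δ → (δ⁻¹ • (A₀ + δ • A₁ + δ ^ 2 • A₂)).charpoly = P) :
    A₀ ^ Module.finrank ℝ V = 0 := by
  set m := Module.finrank ℝ V
  have hPm : P.natDegree = m := by rw [← h 1 one_pos, LinearMap.charpoly_natDegree]
  have hP1 : P.coeff m = 1 := by
    rw [← hPm, Polynomial.coeff_natDegree, ← h 1 one_pos]
    exact LinearMap.charpoly_monic _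
  let c := Module.finBasis ℝ V
  have hX : A₀.charpoly = Polynomial.X ^ m := by
    refine Polynomial.funext fun t ↦ ?_
    -- For `δ > 0` the determinant is `δ ^ m * P(t / δ)`. Writing this as the polynomial `H` in `δ`
    -- lets continuity carry the equality to `δ = 0`, where only the leading term `t ^ m` survives.
    let F : ℝ → ℝ := fun δ ↦ LinearMap.det (algebraMap ℝ _ t - (A₀ + δ • A₁ + δ ^ 2 • A₂))
    let H : ℝ → ℝ := fun δ ↦ ∑ i ∈ Finset.range (m + 1), P.coeff i * t ^ i * δ ^ (m - i)
    have hF : Continuous F := by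
      have : F = fun δ ↦ Matrix.det (LinearMap.toMatrix c c (algebraMap ℝ _ t) -
          (LinearMap.toMatrix c c A₀ + δ • LinearMap.toMatrix c c A₁ +
            δ ^ 2 • LinearMap.toMatrix c c A₂)) := by
        funext δ
        simp only [F, ← LinearMap.det_toMatrix c, map_sub, map_add, map_smul]
      rw [this]
      fun_prop
    have hH : Continuous H := by fun_prop
    have hFH : ∀ δ, 0 < δ → F δ = H δ := by
      intro δ hδ
      have h1 : algebraMap ℝ (Module.End ℝ V) t - (A₀ + δ • A₁ + δ ^ 2 • A₂) =
          δ • (algebraMap ℝ _ (δ⁻¹ * t) - δ⁻¹ • (A₀ + δ • A₁ + δ ^ 2 • A₂)) := by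
        rw [smul_sub, smul_smul, mul_inv_cancel₀ hδ.ne', one_smul, Algebra.algebraMap_eq_smul_one,
          Algebra.algebraMap_eq_smul_one, smul_smul, ← mul_assoc, mul_inv_cancel₀ hδ.ne', one_mul]
      simp only [F, H]
      rw [h1, LinearMap.det_smul, ← LinearMap.eval_charpoly, h δ hδ,
        Polynomial.eval_eq_sum_range, hPm, Finset.mul_sum]
      refine Finset.sum_congr rfl fun i hi ↦ ?_
      have him : i ≤ m := Nat.lt_succ_iff.1 (Finset.mem_range.1 hi)
      obtain ⟨j, hj⟩ := Nat.exists_eq_add_of_le him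
      change δ ^ m * _ = _
      rw [hj, Nat.add_sub_cancel_left, mul_pow, pow_add, inv_pow]
      field_simp
    have h0 : F 0 = H 0 := by
      have hmem : (0 : ℝ) ∈ closure (Set.Ioi (0 : ℝ)) := by simp
      exact (Set.EqOn.closure (fun δ hδ ↦ hFH δ hδ) hF hH) hmem
    have hF0 : F 0 = A₀.charpoly.eval t := by simp [F, LinearMap.eval_charpoly]
    have hH0 : H 0 = t ^ m := by
      simp only [H]
      rw [Finset.sum_range_succ, Finset.sum_eq_zero]
      · simp [hP1]
      · intro i hi
        have : m - i ≠ 0 := by have := Finset.mem_range.1 hi; omega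
        simp [this]
    simp [← hF0, h0, hH0]
  simpa [hX] using LinearMap.aeval_self_charpoly A₀

theorem jacobiOp_smul (c : ℝ) (x : V) : jacobiOp R (c • x) = c ^ 2 • jacobiOp R x := by
  ext y
  simp [jacobiOp_apply, smul_smul, sq]

/-- If the higher order Jacobi operators of all spacelike frames of `k + 1` vectors have the same
characteristic polynomial, then the Jacobi operator of the null vector `b 0 + a` is nilpotent. -/
theorem IsLorentzBasis.jacobiOp_null_pow_eq_zero [FiniteDimensional ℝ V] {q k : ℕ} (hk : k ≤ q)
    {b : Module.Basis (Fin (q + 1 + 1)) ℝ V} (hb : IsLorentzBasis B b)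
    {P : Polynomial ℝ}
    (hP : ∀ f : Fin (k + 1) → V, IsSpacelikeFrame B f → (frameJacobi R f).charpoly = P)
    {a : V} (hea : B (b 0) a = 0) (ha : B a a = 1) :
    jacobiOp R (b 0 + a) ^ Module.finrank ℝ V = 0 := by
  obtain ⟨f, hf, hef⟩ := hb.exists_frame hea ha
  set e := b 0
  have hae : B a e = 0 := by rw [hb.isSymm, hea]
  have hee : B e e = -1 := hb.timelike
  set l := a - e with hl
  set n := e + a with hn
  let C : V →ₗ[ℝ] V := ∑ i : Fin k, jacobiOp R (f (Fin.castLE hk i))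
  let J₁ : V →ₗ[ℝ] V := jacobiOp R (n + l) - jacobiOp R n - jacobiOp R l
  refine pow_finrank_eq_zero_of_charpoly_eq _ ((1 / 4 : ℝ) • J₁ + C)
    ((1 / 16 : ℝ) • jacobiOp R l) P fun δ hδ ↦ ?_
  have hc : (√δ)⁻¹ ^ 2 = δ⁻¹ := by rw [inv_pow, Real.sq_sqrt hδ.le]
  -- Both `n` and `l` are null and `B n l = 2`, so the coefficient `δ / 4` makes `x` a unit vector.
  -- Multiplying the Jacobi sum by `δ` leaves `J(n)` plus terms of order `δ` and `δ ^ 2`.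
  let x : V := (√δ)⁻¹ • (n + (δ / 4) • l)
  have hxx : B x x = 1 := by
    have h1 : B x x = (√δ)⁻¹ ^ 2 * B (n + (δ / 4) • l) (n + (δ / 4) • l) := by
      simp only [x, map_smul, LinearMap.smul_apply, smul_eq_mul]
      ring
    rw [h1, hc]
    simp only [hn, hl, map_add, map_sub, LinearMap.add_apply, LinearMap.sub_apply, map_smul,
      LinearMap.smul_apply, smul_eq_mul, hee, hea, hae, ha]
    field_simp
    ring
  have hxf : ∀ i, B x (f i) = 0 := fun i ↦ by
    simp [x, hn, hl, (hef i).1, (hef i).2]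
  have hframe : IsSpacelikeFrame B (Fin.cons x fun i : Fin k ↦ f (Fin.castLE hk i)) := by
    intro i j
    refine Fin.cases ?_ (fun i ↦ ?_) i <;> refine Fin.cases ?_ (fun j ↦ ?_) j
    · simpa using hxx
    · simp [hxf, (Fin.succ_ne_zero j).symm]
    · simp [hb.isSymm _ x, hxf]
    · simp [hf _ _]
  rw [← hP _ hframe]
  congr 1
  rw [frameJacobi, Fin.sum_univ_succ]
  simp only [Fin.cons_zero, Fin.cons_succ, x, jacobiOp_smul, hc]
  ext y
  simp only [J₁, C, jacobiOp_apply, LinearMap.smul_apply, LinearMap.add_apply,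
    LinearMap.sub_apply, map_add, map_smul, smul_add, smul_sub, smul_smul]
  match_scalars <;> field_simp <;> ring

/-- A self-adjoint nilpotent operator with image in `n^⊥` has `B (A y) y = 0` for `y ∈ n^⊥`, if
`B` is positive semi-definite on `n^⊥`. -/
theorem apply_self_eq_zero_of_pow_eq_zero (hB : ∀ x y, B x y = B y x) {n : V}
    (hpos : ∀ y, B y n = 0 → 0 ≤ B y y) {A : V →ₗ[ℝ] V} (hA : ∀ x y, B (A x) y = B x (A y))
    (hAn : ∀ y, B (A y) n = 0) {N : ℕ} (hN : A ^ N = 0) {y : V} (hy : B y n = 0) :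
    B (A y) y = 0 := by
  have hnull : ∀ u w, B u n = 0 → B w n = 0 → B u u = 0 → B u w = 0 := by
    intro u w hu hw huu
    have key : ∀ t : ℝ, 0 ≤ 2 * t * B u w + t ^ 2 * B w w := by
      intro t
      have := hpos (u + t • w) (by simp [hu, hw])
      simp only [map_add, LinearMap.add_apply, map_smul, LinearMap.smul_apply, smul_eq_mul, huu,
        hB w u] at this
      linarith
    by_contra h
    have hww := hpos w hw
    -- Cauchy–Schwarz for a semi-definite form; the `+ 1` keeps the denominator positive when `w` is
    -- null.
    have h1 := key (-(B u w) / (B w w + 1))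
    have h2 : 2 * (-(B u w) / (B w w + 1)) * B u w + (-(B u w) / (B w w + 1)) ^ 2 * B w w =
        -((B u w) ^ 2 * (B w w + 2) / (B w w + 1) ^ 2) := by
      field_simp
      ring
    have h3 : 0 < (B u w) ^ 2 * (B w w + 2) / (B w w + 1) ^ 2 := by positivity
    linarith
  have hpown : ∀ j z, B z n = 0 → B ((A ^ j) z) n = 0 := by
    intro j z hz
    cases j with
    | zero => simpa using hz
    | succ j => rw [pow_succ', Module.End.mul_apply]; exact hAn _
  -- Pairing `A ^ (j + 2) z` with `A ^ j z` and moving one `A` across shows that `A ^ (j + 1) z` is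
  -- null, hence orthogonal to all of `n^⊥`. The exponent thus descends to one.
  have hstep : ∀ j, (∀ z w, B z n = 0 → B w n = 0 → B ((A ^ (j + 2)) z) w = 0) →
      ∀ z w, B z n = 0 → B w n = 0 → B ((A ^ (j + 1)) z) w = 0 := by
    intro j hj z w hz hw
    refine hnull _ _ (hpown _ _ hz) hw ?_
    have := hj z ((A ^ j) z) hz (hpown _ _ hz)
    rw [pow_succ' A (j + 1), Module.End.mul_apply, hA] at this
    rwa [pow_succ' A j, Module.End.mul_apply] at this ⊢
  have hall : ∀ j, (∀ z w, B z n = 0 → B w n = 0 → B ((A ^ (j + 1)) z) w = 0) →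
      ∀ z w, B z n = 0 → B w n = 0 → B ((A ^ 1) z) w = 0 := by
    intro j
    induction j with
    | zero => exact id
    | succ j ih => exact fun h ↦ ih (hstep j h)
  simpa using hall N (by intro z w _ _; simp [pow_succ, hN]) y y hy hy

/-- The sectional curvature of degenerate planes through the null vectors `b 0 + a` vanishes. -/
theorem IsLorentzBasis.curvature_null_eq_zero [FiniteDimensional ℝ V]
    (hR : IsCurvatureOperator B R) {q k : ℕ} (hk : k ≤ q)
    {b : Module.Basis (Fin (q + 1 + 1)) ℝ V} (hb : IsLorentzBasis B b) {P : Polynomial ℝ}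
    (hP : ∀ f : Fin (k + 1) → V, IsSpacelikeFrame B f → (frameJacobi R f).charpoly = P)
    {a y : V} (hea : B (b 0) a = 0) (ha : B a a = 1) (hy : B y (b 0 + a) = 0) :
    B (R y (b 0 + a) (b 0 + a)) y = 0 := by
  have hee := hb.timelike
  refine apply_self_eq_zero_of_pow_eq_zero (A := jacobiOp R (b 0 + a)) hb.isSymm ?_ ?_ ?_
    (hb.jacobiOp_null_pow_eq_zero hk hP hea ha) hy
  · intro y hy
    have hya : B y a = -B (b 0) y := by
      rw [map_add, hb.isSymm y (b 0)] at hy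
      linarith
    -- By `hya` this vector is `y` plus a multiple of `b 0 + a`, so it has the same square as `y`,
    -- and it is orthogonal to `b 0`.
    have := hb.nonneg_of_orthogonal (y := y + B (b 0) y • b 0 - B y a • a)
      (by simp [hee, hea])
    simp only [map_add, map_sub, LinearMap.add_apply, LinearMap.sub_apply, map_smul,
      LinearMap.smul_apply, smul_eq_mul, hee, hea, ha, hb.isSymm y (b 0), hb.isSymm a (b 0),
      hb.isSymm a y, hya] at this
    linarith
  · intro x y
    rw [jacobiOp_apply, jacobiOp_apply, hR.pair_symm, hR.antisymm, map_neg, LinearMap.neg_apply,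
      hR.skew, neg_neg, hb.isSymm]
  · intro y
    have := hR.skew y (b 0 + a) (b 0 + a) (b 0 + a)
    rw [jacobiOp_apply]
    linarith

/-! ### Constant curvature from vanishing on degenerate planes -/

/-- A Lorentzian algebraic curvature operator is of constant curvature if the Jacobi operators of
its spacelike frames of a given size have constant characteristic polynomial. -/
theorem IsLorentzBasis.exists_forall_curvature_eq [FiniteDimensional ℝ V]
    (hR : IsCurvatureOperator B R) {q k : ℕ} (hk : k ≤ q) (hq : 1 ≤ q)
    {b : Module.Basis (Fin (q + 1 + 1)) ℝ V} (hb : IsLorentzBasis B b) {P : Polynomial ℝ}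
    (hP : ∀ f : Fin (k + 1) → V, IsSpacelikeFrame B f → (frameJacobi R f).charpoly = P) :
    ∃ c : ℝ, ∀ x y, B (R x y y) x = c * (B x x * B y y - B x y ^ 2) := by
  have hee := hb.timelike
  have hnull := fun {a y} ↦ hb.curvature_null_eq_zero hR hk hP (a := a) (y := y)
  set e := b 0
  have hflip : ∀ x y z w, B (R x y z) w = B (R y x w) z := fun x y z w ↦ by
    rw [hR.antisymm, map_neg, LinearMap.neg_apply, hR.skew, neg_neg]
  have hpolar : ∀ x y z, B (R x y z) x = B (R x z y) x := fun x y z ↦ by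
    rw [hR.pair_symm, hflip]
  have hflip' : ∀ x y, B (R x y y) x = B (R y x x) y := fun x y ↦ hflip _ _ _ _
  have hzero : ∀ x y, B (R x x y) x = 0 ∧ B (R x y x) x = 0 := fun x y ↦ by
    have h1 : B (R x x y) x = 0 := by
      have := congrArg (fun u ↦ B u x) (hR.antisymm x x y)
      simp only [map_neg, LinearMap.neg_apply] at this
      linarith
    exact ⟨h1, by rw [hpolar, h1]⟩
  -- the consequences of the vanishing on degenerate planes
  have hrel : ∀ a y, B e a = 0 → B e y = 0 → B a y = 0 →
      B (R y a a) y = -(B a a * B (R y e e) y) ∧ B (R y e a) y = 0 := by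
    intro a y hea hey hay
    rcases eq_or_ne a 0 with rfl | h0
    · simp
    have hpos := hb.pos_of_orthogonal hea h0
    set r := √(B a a)
    have hr : 0 < r := Real.sqrt_pos.2 hpos
    have hr2 : B a a = r ^ 2 := (Real.sq_sqrt hpos.le).symm
    have h1 := @hnull (r⁻¹ • a) y (by simp [hea])
      (by simp only [map_smul, LinearMap.smul_apply, smul_eq_mul, hr2]; field_simp)
      (by simp [hb.isSymm y, hey, hay])
    -- Using both null directions `e ± a / r` separates the terms even in `a` from the mixed term.
    have h2 := @hnull (-(r⁻¹ • a)) y (by simp [hea])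
      (by
        simp only [map_neg, LinearMap.neg_apply, map_smul, LinearMap.smul_apply, smul_eq_mul, hr2]
        field_simp)
      (by simp [hb.isSymm y, hey, hay])
    simp only [map_add, LinearMap.add_apply, map_neg, LinearMap.neg_apply, map_smul,
      LinearMap.smul_apply, smul_eq_mul, hpolar y a e] at h1 h2
    rw [hr2]
    constructor
    · have h3 : B (R y e e) y + r⁻¹ * (r⁻¹ * B (R y a a) y) = 0 := by linarith
      field_simp at h3
      linarith
    · have h3 : r⁻¹ * B (R y e a) y = 0 := by linarith
      exact (mul_eq_zero.1 h3).resolve_left (inv_ne_zero hr.ne')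
  -- The aim is `Q = Q u u • B` on the diagonal of `e^⊥`. Exchanging the two vectors in `hrel`
  -- compares `Q` on orthogonal pairs.
  let Q : V → V → ℝ := fun a d ↦ B (R a e e) d
  have hQsymm : ∀ a d, Q a d = Q d a := fun a d ↦ by
    simp only [Q]
    rw [hR.pair_symm, hflip]
  have hQ : ∀ a d, B e a = 0 → B e d = 0 → B a d = 0 → B a a * Q d d = B d d * Q a a := by
    intro a d ha hd had
    have h1 := (hrel a d ha hd had).1
    have h2 := (hrel d a hd ha (by rw [hb.isSymm, had])).1
    rw [hflip'] at h2
    simp only [Q]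
    linarith
  have hQ0 : ∀ a d, B e a = 0 → B e d = 0 → B a d = 0 → Q a d = 0 := by
    intro a d ha hd had
    rcases eq_or_ne a 0 with rfl | ha0
    · simp [Q]
    rcases eq_or_ne d 0 with rfl | hd0
    · simp [Q]
    have hpa := hb.pos_of_orthogonal ha ha0
    have hpd := hb.pos_of_orthogonal hd hd0
    have h1 := hQ a d ha hd had
    have hda : B d a = 0 := by rw [hb.isSymm, had]
    -- A second orthogonal pair in the span of `a` and `d`; comparing `Q` on it isolates the cross
    -- term `Q a d`.
    have h2 := hQ (a + d) (B d d • a - B a a • d) (by simp [ha, hd]) (by simp [ha, hd])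
      (by simp [had, hda]; ring)
    have e1 : B (a + d) (a + d) = B a a + B d d := by simp [had, hda]
    have e2 : B (B d d • a - B a a • d) (B d d • a - B a a • d) =
        B a a * B d d * (B a a + B d d) := by simp [had, hda]; ring
    have e3 : Q (a + d) (a + d) = Q a a + 2 * Q a d + Q d d := by
      have := hQsymm d a
      simp only [Q, map_add, LinearMap.add_apply] at this ⊢
      linarith
    have e4 : Q (B d d • a - B a a • d) (B d d • a - B a a • d) =
        B d d ^ 2 * Q a a - 2 * B a a * B d d * Q a d + B a a ^ 2 * Q d d := by
      have := hQsymm d a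
      simp only [Q, map_sub, map_smul, LinearMap.sub_apply, LinearMap.smul_apply,
        smul_eq_mul] at this ⊢
      rw [this]
      ring
    rw [e1, e2, e3, e4] at h2
    have h3 : (B a a + B d d) * (4 * (B a a * B d d)) * Q a d = 0 := by
      linear_combination (-1 : ℝ) * h2 + (B a a + B d d) * (B a a - B d d) * h1
    exact (mul_eq_zero.1 h3).resolve_left (by positivity)
  obtain ⟨q, rfl⟩ := Nat.exists_eq_add_of_le' hq
  set u := b (Fin.succ 0)
  have heu : B e u = 0 := hb.timelike_succ 0
  have huu : B u u = 1 := (hb.isSpacelikeFrame_succ 0 0).trans (if_pos rfl)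
  have hQc : ∀ a, B e a = 0 → Q a a = B a a * Q u u := by
    intro a ha
    obtain ⟨t, d, had, hd, hud⟩ : ∃ (t : ℝ) (d : V), a = t • u + d ∧ B e d = 0 ∧ B u d = 0 :=
      ⟨B u a, a - B u a • u, by simp, by simp [ha, heu], by simp [huu]⟩
    have h1 := hQ u d heu hd hud
    have h2 := hQ0 u d heu hd hud
    have h3 := hQsymm d u
    have hdu : B d u = 0 := by rw [hb.isSymm, hud]
    subst had
    simp only [Q, map_add, map_smul, LinearMap.add_apply, LinearMap.smul_apply, smul_eq_mul,
      huu, hud, hdu] at h1 h2 h3 ⊢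
    rw [h2] at h3
    rw [h3, h2]
    linarith
  -- a plane spanned by `a ⟂ e` and `s e + d` with `d ⟂ a, e`
  have hplane : ∀ a y, B e a = 0 → B (R a y y) a = -Q u u * (B a a * B y y - B a y ^ 2) := by
    intro a y ha
    rcases eq_or_ne a 0 with rfl | ha0
    · simp
    have hpa := (hb.pos_of_orthogonal ha ha0).ne'
    obtain ⟨s, t, d, hyd, hd, had⟩ : ∃ (s t : ℝ) (d : V), y = s • e + t • a + d ∧ B e d = 0 ∧
        B a d = 0 := by
      refine ⟨-B e y, B a y / B a a, y - (-B e y) • e - (B a y / B a a) • a, by abel, ?_, ?_⟩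
      · simp [hee, ha]
      · simp [hb.isSymm a e, ha]
        field_simp
        ring
    have hda : B d a = 0 := by rw [hb.isSymm, had]
    have hae : B a e = 0 := by rw [hb.isSymm, ha]
    have hde : B d e = 0 := by rw [hb.isSymm, hd]
    have h1 := hrel d a hd ha hda
    have h2 := hQc a ha
    have h3 := hzero a
    have h4 := hpolar a d e
    simp only [Q] at h2
    subst hyd
    simp only [map_add, map_smul, LinearMap.add_apply, LinearMap.smul_apply, smul_eq_mul,
      h1.1, h1.2, h4, (h3 _).1, (h3 _).2, had, hda, hee, ha, hae, hd, hde, h2, Q]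
    ring
  refine ⟨-Q u u, fun x y ↦ ?_⟩
  by_cases hx : B e x = 0
  · exact hplane x y hx
  -- Subtracting a multiple of `x` makes the other vector orthogonal to `e` and changes neither the
  -- curvature term nor the squared area.
  · have h1 := hplane (y - (B e y / B e x) • x) x (by simp; field_simp; ring)
    have h2 : R x x x = 0 := by
      have := hR.antisymm x x x
      rwa [eq_neg_iff_add_eq_zero, ← two_smul ℝ, smul_eq_zero_iff_right two_ne_zero] at this
    have h3 : B (R y x x) x = 0 := self_eq_neg.1 (hR.skew y x x x)
    simp only [map_sub, map_smul, LinearMap.sub_apply, LinearMap.smul_apply, smul_eq_mul,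
      h2, h3, map_zero, LinearMap.zero_apply, hb.isSymm y x] at h1
    rw [hflip']
    linear_combination h1

/-- The trace of the Jacobi operator of a spacelike frame in constant curvature `c`. -/
theorem IsLorentzBasis.trace_frameJacobi [FiniteDimensional ℝ V]
    (hR : IsCurvatureOperator B R) {q k : ℕ}
    {b : Module.Basis (Fin (q + 1)) ℝ V} (hb : IsLorentzBasis B b) {c : ℝ}
    (hc : ∀ x y, B (R x y y) x = c * (B x x * B y y - B x y ^ 2)) {f : Fin k → V}
    (hf : IsSpacelikeFrame B f) :
    LinearMap.trace ℝ V (frameJacobi R f) = k * q * c := by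
  have hflip : ∀ x y z w, B (R x y z) w = B (R y x w) z := fun x y z w ↦ by
    rw [hR.antisymm, map_neg, LinearMap.neg_apply, hR.skew, neg_neg]
  have hJ : ∀ i, jacobiOp R (f i) = c • (LinearMap.id - (B (f i)).smulRight (f i)) := by
    intro i
    ext y
    rw [← sub_eq_zero]
    refine hb.eq_zero_of_forall fun w ↦ ?_
    -- Polarising `hc` in its first argument recovers the full operator, since the Jacobi operator
    -- is self-adjoint (`h4`).
    have h1 := hc (y + w) (f i)
    have h2 := hc y (f i)
    have h3 := hc w (f i)
    have h4 : B (R w (f i) (f i)) y = B (R y (f i) (f i)) w := by rw [hR.pair_symm, hflip]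
    simp only [map_add, LinearMap.add_apply] at h1
    simp only [jacobiOp_apply, LinearMap.smul_apply, LinearMap.sub_apply, LinearMap.id_apply,
      LinearMap.smulRight_apply, map_sub, map_smul, smul_eq_mul, hf i i, if_true] at h1 h2 h3 ⊢
    rw [h4, hb.isSymm w y] at h1
    rw [hb.isSymm (f i) y, hb.isSymm (f i) w]
    linarith
  have hm : Module.finrank ℝ V = q + 1 := by simp [Module.finrank_eq_card_basis b]
  have ht : ∀ i, LinearMap.trace ℝ V (jacobiOp R (f i)) = q * c := by
    intro i
    rw [hJ, map_smul, map_sub, LinearMap.trace_id, LinearMap.trace_smulRight, hf i i, hm]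
    simp
    ring
  simp [frameJacobi, ht]
  ring

end Algebra


/-! ### Symmetries of the curvature in coordinates -/

section CoordinateCurvature

variable {E : Type*} [NormedAddCommGroup E] [NormedSpace ℝ E]
  {G : E → E →L[ℝ] E →L[ℝ] ℝ} {y₀ : E}

theorem apply_christoffel {y : E} (hG : (G y).IsInvertible) (u v w : E) :
    G y (christoffel G y u v) w = christoffelFirst G y u v w := by
  have : G y (christoffel G y u v) = christoffelFirst G y u v := hG.self_apply_inverse _
  rw [this]

theorem eventually_isInvertible [CompleteSpace E] (hG : ContinuousAt G y₀)
    (hi : (G y₀).IsInvertible) : ∀ᶠ y in nhds y₀, (G y).IsInvertible := by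
  obtain ⟨e, he⟩ := hi
  have := ContinuousLinearEquiv.nhds e
  rw [he] at this
  exact hG this

theorem fderiv_apply_symm (hs : ∀ᶠ y in nhds y₀, ∀ u v, G y u v = G y v u)
    (hG : DifferentiableAt ℝ G y₀) (x u v : E) :
    fderiv ℝ G y₀ x u v = fderiv ℝ G y₀ x v u := by
  have h : ∀ u v, fderiv ℝ (fun y ↦ G y u v) y₀ x = fderiv ℝ G y₀ x u v := by
    intro u v
    have h1 := (hG.hasFDerivAt.clm_apply (hasFDerivAt_const u y₀)).clm_apply
      (hasFDerivAt_const v y₀)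
    rw [h1.fderiv]
    simp
  rw [← h, ← h]
  congr 1
  exact Filter.EventuallyEq.fderiv_eq (hs.mono fun y hy ↦ hy u v)

theorem differentiableAt_christoffelFirst (hG : DifferentiableAt ℝ (fderiv ℝ G) y₀) :
    DifferentiableAt ℝ (christoffelFirst G) y₀ := by
  let flip₁ : (E →L[ℝ] E →L[ℝ] E →L[ℝ] ℝ) →L[ℝ] E →L[ℝ] E →L[ℝ] E →L[ℝ] ℝ :=
    (ContinuousLinearMap.flipₗᵢ ℝ E E (E →L[ℝ] ℝ)).toContinuousLinearEquiv.toContinuousLinearMap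
  let flip₂ : (E →L[ℝ] E →L[ℝ] E →L[ℝ] ℝ) →L[ℝ] E →L[ℝ] E →L[ℝ] E →L[ℝ] ℝ :=
    ContinuousLinearMap.compL ℝ E (E →L[ℝ] E →L[ℝ] ℝ) (E →L[ℝ] E →L[ℝ] ℝ)
      (ContinuousLinearMap.flipₗᵢ ℝ E E ℝ).toContinuousLinearEquiv.toContinuousLinearMap
  let T := (1 / 2 : ℝ) • (ContinuousLinearMap.id ℝ _ + flip₁ - flip₂.comp flip₁)
  have : christoffelFirst G = fun y ↦ T (fderiv ℝ G y) := by
    funext y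
    ext u v w
    simp [T, flip₁, flip₂, christoffelFirst_apply]
  rw [this]
  exact T.differentiableAt.comp y₀ hG

theorem differentiableAt_christoffel [CompleteSpace E] (hG : ContDiffAt ℝ 2 G y₀)
    (hi : (G y₀).IsInvertible) : DifferentiableAt ℝ (christoffel G) y₀ := by
  have h1 : DifferentiableAt ℝ (fun y ↦ (G y).inverse) y₀ :=
    DifferentiableAt.comp (g := ContinuousLinearMap.inverse) y₀
      (hi.contDiffAt_map_inverse (n := 1).differentiableAt one_ne_zero)
      (hG.differentiableAt two_ne_zero)
  have h2 : DifferentiableAt ℝ (fderiv ℝ G) y₀ :=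
    (hG.fderiv_right (m := 1) (by norm_num)).differentiableAt one_ne_zero
  exact ((ContinuousLinearMap.compL ℝ E (E →L[ℝ] ℝ) E).differentiableAt.comp y₀ h1).clm_comp
    (differentiableAt_christoffelFirst h2)

/-- The derivative of the relation between the two kinds of Christoffel symbols. -/
theorem apply_fderiv_christoffel [CompleteSpace E] (hG : ContDiffAt ℝ 2 G y₀)
    (hi : (G y₀).IsInvertible) (x u v w : E) :
    G y₀ (fderiv ℝ (christoffel G) y₀ x u v) w =
      (1 / 2) * (fderiv ℝ (fderiv ℝ G) y₀ x u v w + fderiv ℝ (fderiv ℝ G) y₀ x v u w -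
        fderiv ℝ (fderiv ℝ G) y₀ x w u v) - fderiv ℝ G y₀ x (christoffel G y₀ u v) w := by
  have hD : DifferentiableAt ℝ (fderiv ℝ G) y₀ :=
    (hG.fderiv_right (m := 1) (by norm_num)).differentiableAt one_ne_zero
  have h3 : ∀ a b c, HasFDerivAt (fun y ↦ fderiv ℝ G y a b c) _ y₀ := fun a b c ↦
    ((hD.hasFDerivAt.clm_apply (hasFDerivAt_const a y₀)).clm_apply
      (hasFDerivAt_const b y₀)).clm_apply (hasFDerivAt_const c y₀)
  have h1 := (((h3 u v w).add (h3 v u w)).sub (h3 w u v)).const_mul (1 / 2)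
  have h2 := ((hG.differentiableAt two_ne_zero).hasFDerivAt.clm_apply
    (((differentiableAt_christoffel hG hi).hasFDerivAt.clm_apply
      (hasFDerivAt_const u y₀)).clm_apply (hasFDerivAt_const v y₀))).clm_apply
        (hasFDerivAt_const w y₀)
  have heq : (fun y ↦ G y (christoffel G y u v) w) =ᶠ[nhds y₀] fun y ↦
      (1 / 2) * (fderiv ℝ G y u v w + fderiv ℝ G y v u w - fderiv ℝ G y w u v) := by
    filter_upwards [eventually_isInvertible hG.continuousAt hi] with y hy
    rw [apply_christoffel hy, christoffelFirst_apply]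
  have h4 := congrArg (fun L ↦ L x) ((h1.congr_of_eventuallyEq heq).unique h2)
  simp at h4
  linarith

/-- The curvature tensor in terms of the second derivatives of the metric and the Christoffel
symbols. -/
theorem apply_coordCurvature [CompleteSpace E] (hG : ContDiffAt ℝ 2 G y₀)
    (hs : ∀ᶠ y in nhds y₀, ∀ u v, G y u v = G y v u)
    (hi : (G y₀).IsInvertible) (u v w z : E) :
    G y₀ (coordCurvature G y₀ u v w) z =
      (1 / 2) * (fderiv ℝ (fderiv ℝ G) y₀ u w v z - fderiv ℝ (fderiv ℝ G) y₀ u z v w -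
        fderiv ℝ (fderiv ℝ G) y₀ v w u z + fderiv ℝ (fderiv ℝ G) y₀ v z u w) -
      G y₀ (christoffel G y₀ u z) (christoffel G y₀ v w) +
      G y₀ (christoffel G y₀ v z) (christoffel G y₀ u w) := by
  have hd := hG.differentiableAt two_ne_zero
  have hsymm := (hG.isSymmSndFDerivAt (by simp)).eq u v
  -- Metric compatibility: one of the two terms cancels the quadratic Christoffel term of the
  -- curvature, the other gives the products in the result.
  have hcompat : ∀ x a b, fderiv ℝ G y₀ x a b =
      christoffelFirst G y₀ x a b + christoffelFirst G y₀ x b a := by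
    intro x a b
    rw [christoffelFirst_apply, christoffelFirst_apply, fderiv_apply_symm hs hd x b a]
    ring
  simp only [coordCurvature, map_add, map_sub, add_apply, sub_apply,
    apply_fderiv_christoffel hG hi, hcompat, apply_christoffel hi]
  rw [hsymm]
  ring

theorem fderiv_fderiv_apply_symm (hG : ContDiffAt ℝ 2 G y₀)
    (hs : ∀ᶠ y in nhds y₀, ∀ u v, G y u v = G y v u) (x z u v : E) :
    fderiv ℝ (fderiv ℝ G) y₀ x z u v = fderiv ℝ (fderiv ℝ G) y₀ x z v u := by
  have hD : DifferentiableAt ℝ (fderiv ℝ G) y₀ :=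
    (hG.fderiv_right (m := 1) (by norm_num)).differentiableAt one_ne_zero
  have h := fderiv_apply_symm (G := fun y ↦ fderiv ℝ G y z) (y₀ := y₀) ?_
    (hD.clm_apply (differentiableAt_const z)) x u v
  · rw [(hD.hasFDerivAt.clm_apply (hasFDerivAt_const z y₀)).fderiv] at h
    simpa using h
  · filter_upwards [hs.eventually_nhds, hG.eventually (by simp)] with y hy hy' u v
    exact fderiv_apply_symm hy (hy'.differentiableAt two_ne_zero) z u v

theorem coordCurvature_antisymm (G : E → E →L[ℝ] E →L[ℝ] ℝ) (y u v w : E) :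
    coordCurvature G y u v w = -coordCurvature G y v u w := by
  simp only [coordCurvature]
  abel

/-- The curvature operator in coordinates as a trilinear map. -/
noncomputable def coordCurvatureₗ (G : E → E →L[ℝ] E →L[ℝ] ℝ) (y : E) :
    E →ₗ[ℝ] E →ₗ[ℝ] E →ₗ[ℝ] E :=
  LinearMap.mk₂ ℝ
    (fun u v ↦
      { toFun := coordCurvature G y u v
        map_add' := fun w w' ↦ by simp only [coordCurvature, map_add]; abel
        map_smul' := fun c w ↦ by
          simp only [coordCurvature, map_smul, smul_add, smul_sub, RingHom.id_apply] })
    (fun u u' v ↦ LinearMap.ext fun w ↦ coordCurvature_add G y u u' v w)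
    (fun c u v ↦ LinearMap.ext fun w ↦ coordCurvature_smul G y c u v w)
    (fun u v v' ↦ LinearMap.ext fun w ↦ by
      change coordCurvature G y u (v + v') w =
        coordCurvature G y u v w + coordCurvature G y u v' w
      rw [coordCurvature_antisymm, coordCurvature_add, neg_add, ← coordCurvature_antisymm,
        ← coordCurvature_antisymm])
    (fun c u v ↦ LinearMap.ext fun w ↦ by
      change coordCurvature G y u (c • v) w = c • coordCurvature G y u v w
      rw [coordCurvature_antisymm, coordCurvature_smul, ← smul_neg, ← coordCurvature_antisymm])

@[simp]
theorem coordCurvatureₗ_apply (G : E → E →L[ℝ] E →L[ℝ] ℝ) (y u v w : E) :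
    coordCurvatureₗ G y u v w = coordCurvature G y u v w := rfl

end CoordinateCurvature


/-- Antisymmetry is formal. The other symmetries can be read off from `apply_coordCurvature`, using
that second derivatives commute, that `G` is symmetric, and that the connection is torsion-free
(`h4`). -/
theorem isCurvatureOperator_coordCurvature {E : Type*} [NormedAddCommGroup E] [NormedSpace ℝ E]
    [CompleteSpace E] {G : E → E →L[ℝ] E →L[ℝ] ℝ} {y₀ : E} (hG : ContDiffAt ℝ 2 G y₀)
    (hs : ∀ᶠ y in nhds y₀, ∀ u v, G y u v = G y v u) (hi : (G y₀).IsInvertible)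
    {B : E →ₗ[ℝ] E →ₗ[ℝ] ℝ} (hB : ∀ u v, B u v = G y₀ u v) :
    IsCurvatureOperator B (coordCurvatureₗ G y₀) := by
  have h1 := fun x y ↦ (hG.isSymmSndFDerivAt (by simp)).eq x y
  have h2 := fderiv_fderiv_apply_symm hG hs
  have h3 := hs.self_of_nhds
  have h4 : ∀ u v, christoffel G y₀ u v = christoffel G y₀ v u := by
    intro u v
    have : christoffelFirst G y₀ u v = christoffelFirst G y₀ v u := by
      ext w
      rw [christoffelFirst_apply, christoffelFirst_apply,
        fderiv_apply_symm hs (hG.differentiableAt two_ne_zero) w u v]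
      ring
    exact congrArg (G y₀).inverse this
  constructor
  · exact fun u v w ↦ coordCurvature_antisymm G y₀ u v w
  · intro u v w z
    simp only [hB, coordCurvatureₗ_apply, apply_coordCurvature hG hs hi]
    rw [h3 (christoffel G y₀ u z), h3 (christoffel G y₀ v z)]
    ring
  · intro u v w z
    simp only [hB, coordCurvatureₗ_apply, apply_coordCurvature hG hs hi]
    rw [h1 w u, h1 w v, h1 z u, h1 z v, h2 u w z v, h2 u z w v, h2 v w z u, h2 v z w u,
      h4 w v, h4 z u, h4 z v, h4 w u, h3 (christoffel G y₀ v w)]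
    ring

/-! ### Spectrum, characteristic polynomial and trace -/

/-- A monic polynomial that splits over `ℂ` is the product of its linear factors. Two spaces are
allowed because tangent spaces at different points are compared. -/
theorem charpoly_eq_of_eigenvalues_eq {V W : Type*} [AddCommGroup V] [Module ℝ V]
    [FiniteDimensional ℝ V] [AddCommGroup W] [Module ℝ W] [FiniteDimensional ℝ W]
    {A : V →ₗ[ℝ] V} {A' : W →ₗ[ℝ] W} (h : LorentzianMetric.eigenvalues A = LorentzianMetric.eigenvalues A') :
    A.charpoly = A'.charpoly := by
  refine Polynomial.map_injective _ (algebraMap ℝ ℂ).injective ?_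
  rw [(IsAlgClosed.splits (A.charpoly.map (algebraMap ℝ ℂ))).eq_prod_roots_of_monic
      (A.charpoly_monic.map _),
    (IsAlgClosed.splits (A'.charpoly.map (algebraMap ℝ ℂ))).eq_prod_roots_of_monic
      (A'.charpoly_monic.map _)]
  exact congrArg (fun s : Multiset ℂ ↦ (s.map fun a ↦ Polynomial.X - Polynomial.C a).prod) h

theorem trace_eq_of_charpoly_eq {V W : Type*} [AddCommGroup V] [Module ℝ V]
    [FiniteDimensional ℝ V] [AddCommGroup W] [Module ℝ W] [FiniteDimensional ℝ W]
    {A : V →ₗ[ℝ] V} {A' : W →ₗ[ℝ] W} (h : A.charpoly = A'.charpoly) :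
    LinearMap.trace ℝ V A = LinearMap.trace ℝ W A' := by
  rw [LinearMap.trace_eq_matrix_trace ℝ (Module.finBasis ℝ V),
    LinearMap.trace_eq_matrix_trace ℝ (Module.finBasis ℝ W),
    Matrix.trace_eq_neg_charpoly_nextCoeff, Matrix.trace_eq_neg_charpoly_nextCoeff,
    LinearMap.charpoly_toMatrix, LinearMap.charpoly_toMatrix, h]

/-! ### Passing from charts to tangent spaces -/

namespace LorentzianMetric

variable {E : Type*} [NormedAddCommGroup E] [NormedSpace ℝ E]
variable {M : Type*} [TopologicalSpace M] [ChartedSpace E M] [IsManifold 𝓘(ℝ, E) ∞ M]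
variable (g : LorentzianMetric E M)

/-- The tangent space at `p` is modelled on `E` through this very chart, so at `p` the curvature is
literally the coordinate expression. -/
theorem dchart_eq (p : M) : dchart (E := E) p = ContinuousLinearMap.id ℝ _ :=
  mfderiv_extChartAt_self

theorem dchartSymm_eq (p : M) : dchartSymm (E := E) p = ContinuousLinearMap.id ℝ _ := by
  have := mfderivWithin_range_extChartAt_symm (I := 𝓘(ℝ, E)) (x := p)
  rw [modelWithCornersSelf_coe, Set.range_id, mfderivWithin_univ] at this
  exact this

theorem chartMetric_apply (p : M) (y u v : E) :
    g.chartMetric p y u v = g.inner ((extChartAt 𝓘(ℝ, E) p).symm y)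
      (mfderiv 𝓘(ℝ, E) 𝓘(ℝ, E) (extChartAt 𝓘(ℝ, E) p).symm y u)
      (mfderiv 𝓘(ℝ, E) 𝓘(ℝ, E) (extChartAt 𝓘(ℝ, E) p).symm y v) := rfl

theorem chartMetric_symm (p : M) (y u v : E) :
    g.chartMetric p y u v = g.chartMetric p y v u := by
  rw [chartMetric_apply, chartMetric_apply]
  exact g.symm _ _ _

theorem chartMetric_self (p : M) (u v : E) :
    g.chartMetric p (extChartAt 𝓘(ℝ, E) p p) u v = g.inner p u v := by
  have h1 := dchartSymm_eq (E := E) p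
  let inn : M → E →L[ℝ] E →L[ℝ] ℝ := g.inner
  have h2 : g.chartMetric p (extChartAt 𝓘(ℝ, E) p p) u v =
      inn ((extChartAt 𝓘(ℝ, E) p).symm (extChartAt 𝓘(ℝ, E) p p))
        (dchartSymm (E := E) p u) (dchartSymm (E := E) p v) := rfl
  rw [h2, h1, extChartAt_to_inv]
  rfl

/-- Near the base point, the chart metric is the trivialised section of the bundle of bilinear forms
composed with `φ⁻¹`, because the inverse tangent trivialisation is the derivative of `φ⁻¹`. -/
theorem contDiffAt_chartMetric (p : M) :
    ContDiffAt ℝ ∞ (g.chartMetric p) (extChartAt 𝓘(ℝ, E) p p) := by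
  have h1 := ((contMDiffAt_hom_bundle _).1 (g.contMDiff p)).2
  have h2 : ContMDiffAt 𝓘(ℝ, E) 𝓘(ℝ, E) ∞ (extChartAt 𝓘(ℝ, E) p).symm
      (extChartAt 𝓘(ℝ, E) p p) :=
    (contMDiffOn_extChartAt_symm p).contMDiffAt (extChartAt_target_mem_nhds p)
  have h3 := ContMDiffAt.comp_of_eq h1 h2 (extChartAt_to_inv p)
  refine (h3.congr_of_eventuallyEq ?_).contDiffAt
  filter_upwards [extChartAt_target_mem_nhds (I := 𝓘(ℝ, E)) p] with y hy
  ext u v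
  have hsrc : (extChartAt 𝓘(ℝ, E) p).symm y ∈ (chartAt E p).source := by
    rw [← extChartAt_source (I := 𝓘(ℝ, E))]
    exact (extChartAt 𝓘(ℝ, E) p).map_target hy
  have h4 := TangentBundle.symmL_trivializationAt (I := 𝓘(ℝ, E)) (𝕜 := ℝ) hsrc
  rw [(extChartAt 𝓘(ℝ, E) p).right_inv hy, modelWithCornersSelf_coe, Set.range_id,
    mfderivWithin_univ] at h4
  rw [chartMetric_apply, Function.comp_apply, inCoordinates_apply_eq₂ (by simpa using hsrc)
    (by simpa using hsrc) (Set.mem_univ _)]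
  rw [← h4]
  have hbase : (extChartAt 𝓘(ℝ, E) p).symm y ∈
      (trivializationAt E (TangentSpace 𝓘(ℝ, E)) p).baseSet := hsrc
  erw [Bundle.Trivialization.symmL_apply _ hbase, Bundle.Trivialization.symmL_apply _ hbase]
  simp

/-- The metric at `p` as a bilinear form. -/
noncomputable def innerₗ (p : M) :
    TangentSpace 𝓘(ℝ, E) p →ₗ[ℝ] TangentSpace 𝓘(ℝ, E) p →ₗ[ℝ] ℝ :=
  LinearMap.mk₂ ℝ (fun x y ↦ g.inner p x y) (by simp) (by simp) (by simp) (by simp)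

/-- The curvature operator at `p` as a trilinear map. -/
noncomputable def curvatureₗ (p : M) :
    TangentSpace 𝓘(ℝ, E) p →ₗ[ℝ] TangentSpace 𝓘(ℝ, E) p →ₗ[ℝ] TangentSpace 𝓘(ℝ, E) p →ₗ[ℝ]
      TangentSpace 𝓘(ℝ, E) p :=
  coordCurvatureₗ (E := E) (g.chartMetric p) (extChartAt 𝓘(ℝ, E) p p)

theorem curvatureₗ_apply (p : M) (x y z : TangentSpace 𝓘(ℝ, E) p) :
    g.curvatureₗ p x y z = g.curvature p x y z := by
  rw [curvature, dchart_eq, dchartSymm_eq]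
  rfl

theorem isInvertible_chartMetric [FiniteDimensional ℝ E] (p : M) :
    (g.chartMetric p (extChartAt 𝓘(ℝ, E) p p)).IsInvertible := by
  obtain ⟨q, b, hb⟩ := g.signature p
  have hb' : IsLorentzBasis (g.innerₗ p) b := hb
  let G : E →ₗ[ℝ] (E →L[ℝ] ℝ) := (g.chartMetric p (extChartAt 𝓘(ℝ, E) p p)).toLinearMap
  have hinj : Function.Injective G := by
    refine (injective_iff_map_eq_zero G).2 fun x hx ↦ hb'.eq_zero_of_forall (x := x) fun y ↦ ?_
    exact (g.chartMetric_self p x y).symm.trans (congrArg (fun L : E →L[ℝ] ℝ ↦ L y) hx)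
  have hdim : Module.finrank ℝ E = Module.finrank ℝ (E →L[ℝ] ℝ) := by
    rw [← LinearEquiv.finrank_eq (LinearMap.toContinuousLinearMap (𝕜 := ℝ) (E := E) (F' := ℝ))]
    exact (Subspace.dual_finrank_eq (K := ℝ) (V := E)).symm
  refine ⟨(LinearEquiv.ofInjectiveOfFinrankEq G hinj hdim).toContinuousLinearEquiv, ?_⟩
  ext x y
  rfl

theorem isCurvatureOperator [FiniteDimensional ℝ E] (p : M) :
    IsCurvatureOperator (g.innerₗ p) (g.curvatureₗ p) :=
  haveI : CompleteSpace E := FiniteDimensional.complete ℝ E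
  isCurvatureOperator_coordCurvature (E := E)
    ((g.contDiffAt_chartMetric p).of_le (by norm_cast))
    (Filter.Eventually.of_forall fun y u v ↦ g.chartMetric_symm p y u v)
    (g.isInvertible_chartMetric p) fun u v ↦ (g.chartMetric_self p u v).symm

theorem higherJacobi_eq (p : M) {k : ℕ} {f : Fin k → TangentSpace 𝓘(ℝ, E) p}
    (hf : IsSpacelikeFrame (g.innerₗ p) f) :
    g.higherJacobi p f = frameJacobi (g.curvatureₗ p) f := by
  refine Finset.sum_congr rfl fun i _ ↦ ?_
  have : g.inner p (f i) (f i) = 1 := (hf i i).trans (if_pos rfl)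
  rw [this, one_smul]
  ext y
  rw [jacobiOp_apply, curvatureₗ_apply]
  rfl

/-- A spacelike frame spans a non-degenerate plane, and all signs in its higher Jacobi operator are
`+1`. -/
theorem IsOsserman.exists_charpoly_eq [FiniteDimensional ℝ E] {g : LorentzianMetric E M} {k : ℕ}
    (hR : g.IsOsserman k) :
    ∃ Λ : Multiset ℂ, ∀ (p : M) (f : Fin k → TangentSpace 𝓘(ℝ, E) p),
      IsSpacelikeFrame (g.innerₗ p) f →
        eigenvalues (frameJacobi (g.curvatureₗ p) f) = Λ := by
  obtain ⟨Λ, hΛ⟩ := hR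
  refine ⟨Λ, fun p f hf ↦ ?_⟩
  rw [← higherJacobi_eq g p hf]
  refine hΛ p (Submodule.span ℝ (Set.range f)) ?_ ?_ f ⟨rfl, ?_, ?_⟩
  · simpa using finrank_span_eq_card hf.linearIndependent
  · exact fun x hx h ↦ hf.eq_zero_of_mem_span hx fun j ↦ h _ (Submodule.subset_span ⟨j, rfl⟩)
  · exact fun i j hij ↦ (hf i j).trans (if_neg hij)
  · exact fun i ↦ Or.inl ((hf i i).trans (if_pos rfl))

end LorentzianMetric

end Osserman

/-! ### From pointwise to global constancy -/

theorem theorem1p3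
    {E : Type*} [NormedAddCommGroup E] [NormedSpace ℝ E] [FiniteDimensional ℝ E]
    (hm : 3 ≤ Module.finrank ℝ E)
    {M : Type*} [TopologicalSpace M] [ChartedSpace E M] [IsManifold 𝓘(ℝ, E) ∞ M]
    (g : Osserman.LorentzianMetric E M)
    (k : ℕ) (hk : 1 ≤ k) (hkm : k ≤ Module.finrank ℝ E - 1)
    (hR : g.IsOsserman k) :
    g.HasConstantSectionalCurvature := by
  obtain ⟨Λ, hΛ⟩ := hR.exists_charpoly_eq
  obtain ⟨k, rfl⟩ := Nat.exists_eq_add_of_le' hk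
  obtain ⟨q, hq⟩ : ∃ q, Module.finrank ℝ E = q + 1 + 1 := ⟨Module.finrank ℝ E - 2, by omega⟩
  have hpt : ∀ p : M, ∃ c : ℝ, (∀ x y, g.innerₗ p (g.curvatureₗ p x y y) x =
      c * (g.innerₗ p x x * g.innerₗ p y y - g.innerₗ p x y ^ 2)) ∧
      ∃ f : Fin (k + 1) → TangentSpace 𝓘(ℝ, E) p, Osserman.IsSpacelikeFrame (g.innerₗ p) f ∧
        LinearMap.trace ℝ _ (Osserman.frameJacobi (g.curvatureₗ p) f) =
          (k + 1 : ℕ) * (q + 1 : ℕ) * c := by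
    intro p
    obtain ⟨q', b, hb⟩ := g.signature p
    obtain rfl : q' = q + 1 := by
      have h1 : Module.finrank ℝ (TangentSpace 𝓘(ℝ, E) p) = q' + 1 := by
        simp [Module.finrank_eq_card_basis b]
      have h2 : Module.finrank ℝ E = q' + 1 := h1
      omega
    have hb' : Osserman.IsLorentzBasis (g.innerₗ p) b := hb
    have hkq : k + 1 ≤ q + 1 := by omega
    have hf : Osserman.IsSpacelikeFrame (g.innerₗ p)
        -- A reference frame of spacelike basis vectors; `k ≤ m - 1` guarantees that there are
        -- enough of them.
        (fun i : Fin (k + 1) ↦ b (Fin.castLE hkq i).succ) := fun i j ↦ by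
      rw [hb'.isSpacelikeFrame_succ]
      simp
    obtain ⟨c, hc⟩ := hb'.exists_forall_curvature_eq (g.isCurvatureOperator p) (k := k)
      (by omega) (by omega) fun f' hf' ↦
        Osserman.charpoly_eq_of_eigenvalues_eq ((hΛ p f' hf').trans (hΛ p _ hf).symm)
    exact ⟨c, hc, _, hf, hb'.trace_frameJacobi (g.isCurvatureOperator p) hc hf⟩
  choose c hc f hf htr using hpt
  have hconst : ∀ p p', c p = c p' := by
    intro p p'
    have h := Osserman.trace_eq_of_charpoly_eq (Osserman.charpoly_eq_of_eigenvalues_eq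
      ((hΛ p _ (hf p)).trans (hΛ p' _ (hf p')).symm))
    rw [htr, htr] at h
    -- The factor `(k + 1) * (q + 1)`, plane dimension times `m - 1`, is non-zero, so equal traces
    -- give equal constants.
    exact mul_left_cancel₀ (by positivity) h
  have hsec : ∀ p x y, g.areaSq p x y ≠ 0 →
      g.curvatureTensor p x y y x / g.areaSq p x y = c p := by
    intro p x y h
    rw [div_eq_iff h, Osserman.LorentzianMetric.curvatureTensor, ← g.curvatureₗ_apply]
    exact hc p x y
  rcases isEmpty_or_nonempty M with hM | ⟨⟨p₀⟩⟩
  · exact ⟨0, fun p ↦ (hM.false p).elim⟩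
  · exact ⟨c p₀, fun p x y h ↦ (hsec p x y h).trans (hconst p p₀)⟩
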